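/- Let $l^1$ and $l^\infty$ be the complex Banach spaces of absolutely summable, respectively bounded, sequences, with $l^\infty=(l^1)^*$ through $\langle x,y\rangle=\sum_n x_ny_n$. Let $\mathbb D$ be the open unit disc of $\mathbb C$, and write $\sigma$ and $\sigma_p$ for the spectrum and the point spectrum (set of eigenvalues). For a bounded operator $R$ on a complex Banach space $X$ and $x\in X$ let \[J_R(x)=\{y\in X:\ \text{there are natural numbers } k_1<k_2<\cdots \text{ and } x_n\to x \text{ in } X \text{ with } R^{k_n}x_n\to y\},\] \[J_R^{mix}(x)=\{y\in X:\ \text{there are } x_n\to x \text{ in } X \text{ with } R^{n}x_n\to y\}.\] $R$ is called $J$-class (respectively $J^{mix}$-class) if $J_R(x)=X$ (respectively $J_R^{mix}(x)=X$) for some $x\neq 0$. Put $\kappa(R)=\inf\{\|Rx\|:\|x\|=1\}$ and $i(R)=\lim_{n\to\infty}\kappa(R^n)^{1/n}$. Let $S$ be a bounded operator on $l^1$ and $T=S^*$ its Banach space adjoint, a bounded operator on $l^\infty$. Then the limit defining $i(S)$ exists, and the following statements are equivalent: (i) $T$ is $J^{mix}$-class. (ii) $T$ is $J$-class. (iii)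 $J_T(x)$ has non-empty interior for some non-zero vector $x\in l^\infty$. (iv) $\sigma(T)\cap\partial\mathbb D\neq\emptyset$ and $\sigma_p(T^*)\cap\overline{\mathbb D}=\emptyset$, where $T^*$ is the Banach space adjoint of $T$ on $(l^\infty)^*$. (v) $i(S)>1$ and $\overline{\mathbb D}\subseteq\sigma_p(T)$. (vi) $i(S)>1$ and $0\in\sigma_p(T)$. In particular, $T$ is $J$-class if and only if $i(S)>1$ and $T$ has non-trivial kernel. -/

import Mathlib

open Filter Topology
open scoped ENNReal

noncomputable section

/-- The complex Banach space `l^1` of absolutely summable sequences. -/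
abbrev EllOne : Type := lp (fun _ : ℕ => ℂ) 1

/-- The complex Banach space `l^∞` of bounded sequences with the sup-norm. -/
abbrev EllInfty : Type := lp (fun _ : ℕ => ℂ) ∞

/-- `T = S*`: under the identification of `l^∞` with the dual of `l^1` given by
`⟨x, y⟩ = ∑ x_n y_n`, the operator `T` is the Banach space adjoint of `S`, that is
`⟨S x, y⟩ = ⟨x, T y⟩`. Both series converge absolutely. -/
def IsAdjointOf (T : EllInfty →L[ℂ] EllInfty) (S : EllOne →L[ℂ] EllOne) : Prop :=
  ∀ (x : EllOne) (y : EllInfty), ∑' n, S x n * y n = ∑' n, x n * T y n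

section General

variable {E : Type*} [NormedAddCommGroup E] [NormedSpace ℂ E]

/-- The Banach space adjoint `T* : E* → E*`, `T* f = f ∘ T`. -/
def banachAdjoint (T : E →L[ℂ] E) : StrongDual ℂ E →L[ℂ] StrongDual ℂ E :=
  ContinuousLinearMap.precomp ℂ T

/-- The `J`-set of `x` under `T`. -/
def JSet (T : E →L[ℂ] E) (x : E) : Set E :=
  {y | ∃ k : ℕ → ℕ, StrictMono k ∧ ∃ u : ℕ → E, Tendsto u atTop (𝓝 x) ∧
    Tendsto (fun n => (T ^ k n) (u n)) atTop (𝓝 y)}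

/-- The `J^mix`-set of `x` under `T`: the whole sequence of powers is used. -/
def JMixSet (T : E →L[ℂ] E) (x : E) : Set E :=
  {y | ∃ u : ℕ → E, Tendsto u atTop (𝓝 x) ∧ Tendsto (fun n => (T ^ n) (u n)) atTop (𝓝 y)}

/-- `T` is a `J`-class operator. -/
def IsJClass (T : E →L[ℂ] E) : Prop := ∃ x : E, x ≠ 0 ∧ JSet T x = Set.univ

/-- `T` is a `J^mix`-class operator. -/
def IsJMixClass (T : E →L[ℂ] E) : Prop := ∃ x : E, x ≠ 0 ∧ JMixSet T x = Set.univ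

/-- The point spectrum (set of eigenvalues) of `T`. -/
def pointSpectrum (T : E →L[ℂ] E) : Set ℂ :=
  {z | Module.End.HasEigenvalue (T : E →ₗ[ℂ] E) z}

/-- The injectivity modulus `κ(T) = inf {‖T x‖ : ‖x‖ = 1}`. -/
def injModulus (T : E →L[ℂ] E) : ℝ :=
  sInf ((fun x => ‖T x‖) '' Metric.sphere (0 : E) 1)

/-- `i(T) = lim κ(T^n)^(1/n)`. -/
def injRadius (T : E →L[ℂ] E) : ℝ :=
  limUnder atTop (fun n : ℕ => injModulus (T ^ n) ^ (1 / (n : ℝ)))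

end General

end

noncomputable section

/-! ### Injectivity modulus and existence of the limit `i(S)` -/

section InjModulus

variable {X : Type*} [NormedAddCommGroup X] [NormedSpace ℂ X]

/-! The link between the conditions is the estimate `c‖x‖ ≤ ‖S x - z • x‖` with one `c > 0` for all
`z` in the closed unit disc.

An open set inside a `J`-set rules out eigenvalues of `T*` in that disc, because an eigenfunctional
has constant modulus on a `J`-set. Then every `T - z` has dense range, so normalized approximate
eigenvectors of `S` would be weakly null. The Schur property of `l^1` forbids this, and compactness
of the disc makes the bound uniform (`exists_bddBelow_of_denseRange`).

The uniform bound has two consequences. It forces `i(S) > 1` (`one_lt_injRadius_of_bddBelow`, by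
averaging over roots of unity). It also makes invertibility of `S - z` the same for all `z` in the
disc, which is connected (`isUnit_sub_of_bddBelow`). By duality, one spectral point of `T` on the
circle therefore makes every point of the disc an eigenvalue of `T`, and with `i(S) > 1` an
injective `T` has `J`-sets only at `0`.

Conversely, if `i(S) > 1`, Hahn-Banach solves `T^n u = y` with exponentially small `u`. Adding these
`u` to a kernel vector `x` shows that `J^mix` of `x` is everything. -/

theorem injModulus_nonneg (A : X →L[ℂ] X) : 0 ≤ injModulus A :=
  Real.sInf_nonneg (by rintro _ ⟨x, -, rfl⟩; exact norm_nonneg _)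

theorem injModulus_mul_norm_le (A : X →L[ℂ] X) (x : X) : injModulus A * ‖x‖ ≤ ‖A x‖ := by
  rcases eq_or_ne x 0 with rfl | hx
  · simp
  have hx' : 0 < ‖x‖ := norm_pos_iff.2 hx
  have h : injModulus A ≤ ‖A ((‖x‖⁻¹ : ℂ) • x)‖ := by
    refine csInf_le ⟨0, ?_⟩ ⟨_, ?_, rfl⟩
    · rintro _ ⟨x, -, rfl⟩; exact norm_nonneg _
    · simp [norm_smul, hx'.ne']
  rw [map_smul, norm_smul, norm_inv, Complex.norm_real, norm_norm, inv_mul_eq_div,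
    le_div_iff₀ hx'] at h
  exact h

theorem le_injModulus [Nontrivial X] {A : X →L[ℂ] X} {c : ℝ} (h : ∀ x, c * ‖x‖ ≤ ‖A x‖) :
    c ≤ injModulus A := by
  refine le_csInf ((NormedSpace.sphere_nonempty.2 zero_le_one).image _) ?_
  rintro _ ⟨x, hx, rfl⟩
  have := h x
  rwa [mem_sphere_zero_iff_norm.1 hx, mul_one] at this

theorem injModulus_mul_le [Nontrivial X] (A B : X →L[ℂ] X) :
    injModulus A * injModulus B ≤ injModulus (A * B) := by
  refine le_injModulus fun x => ?_
  calc injModulus A * injModulus B * ‖x‖ = injModulus A * (injModulus B * ‖x‖) := by ring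
    _ ≤ injModulus A * ‖B x‖ := by
      gcongr
      · exact injModulus_nonneg A
      · exact injModulus_mul_norm_le B x
    _ ≤ ‖A (B x)‖ := injModulus_mul_norm_le A _

theorem injModulus_le_norm [Nontrivial X] (A : X →L[ℂ] X) : injModulus A ≤ ‖A‖ := by
  obtain ⟨x, hx⟩ := exists_ne (0 : X)
  exact le_of_mul_le_mul_right ((injModulus_mul_norm_le A x).trans (A.le_opNorm x))
    (norm_pos_iff.2 hx)

theorem injModulus_pos_of_mul [Nontrivial X] {A B : X →L[ℂ] X} (h : 0 < injModulus (A * B)) :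
    0 < injModulus B := by
  have key : ∀ x, injModulus (A * B) * ‖x‖ ≤ ‖A‖ * ‖B x‖ := fun x =>
    (injModulus_mul_norm_le (A * B) x).trans (A.le_opNorm _)
  have hA : 0 < ‖A‖ := by
    obtain ⟨x, hx⟩ := exists_ne (0 : X)
    refine (norm_nonneg A).lt_of_ne fun h0 => ?_
    have := key x
    rw [← h0, zero_mul] at this
    exact (mul_pos h (norm_pos_iff.2 hx)).not_ge this
  refine (div_pos h hA).trans_le (le_injModulus fun x => ?_)
  rw [div_mul_eq_mul_div, div_le_iff₀ hA, mul_comm ‖B x‖]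
  exact key x

theorem pow_injModulus_le [Nontrivial X] (A : X →L[ℂ] X) (n : ℕ) :
    injModulus A ^ n ≤ injModulus (A ^ n) := by
  induction n with
  | zero => exact le_injModulus fun x => by simp
  | succ n ih =>
    rw [pow_succ, pow_succ]
    exact (mul_le_mul_of_nonneg_right ih (injModulus_nonneg A)).trans (injModulus_mul_le _ _)

theorem tendsto_injRadius [Nontrivial X] (S : X →L[ℂ] X) :
    Tendsto (fun n : ℕ => injModulus (S ^ n) ^ (1 / (n : ℝ))) atTop (𝓝 (injRadius S)) := by
  refine tendsto_nhds_limUnder ?_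
  rcases (injModulus_nonneg S).eq_or_lt with h0 | hpos
  -- If `κ(S) = 0`, then `κ(S^n) = 0` for every `n ≥ 1`. Otherwise Fekete's lemma applies to `-log
  -- κ(S^n)`.
  · refine ⟨0, tendsto_const_nhds.congr' ?_⟩
    filter_upwards [eventually_ge_atTop 1] with n hn
    have hz : injModulus (S ^ n) = 0 := by
      by_contra hne
      have hp := (injModulus_nonneg (S ^ n)).lt_of_ne' hne
      obtain ⟨m, rfl⟩ := Nat.exists_eq_add_of_le' hn
      rw [pow_succ] at hp
      exact (injModulus_pos_of_mul hp).ne h0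
    rw [hz, Real.zero_rpow]
    have : (0 : ℝ) < n := by exact_mod_cast hn
    positivity
  · have hpow : ∀ n, 0 < injModulus (S ^ n) := fun n =>
      (pow_pos hpos n).trans_le (pow_injModulus_le S n)
    have hsub : Subadditive fun n : ℕ => -Real.log (injModulus (S ^ n)) := by
      intro m n
      rw [← neg_add, neg_le_neg_iff, ← Real.log_mul (hpow m).ne' (hpow n).ne', pow_add]
      exact Real.log_le_log (mul_pos (hpow m) (hpow n)) (injModulus_mul_le _ _)
    have hbdd : BddBelow (Set.range fun n : ℕ => -Real.log (injModulus (S ^ n)) / n) := by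
      -- The `0` covers `n = 0`, where division by zero gives `0`.
      refine ⟨min 0 (-Real.log ‖S‖), ?_⟩
      rintro _ ⟨n, rfl⟩
      dsimp only
      rcases Nat.eq_zero_or_pos n with rfl | hn
      · simp
      · refine (min_le_right _ _).trans ?_
        have hn' : (0 : ℝ) < n := by exact_mod_cast hn
        rw [le_div_iff₀ hn', neg_mul, neg_le_neg_iff, mul_comm, ← Real.log_pow]
        exact Real.log_le_log (hpow n) ((injModulus_le_norm _).trans (norm_pow_le' S hn))
    refine ⟨Real.exp (-hsub.lim), ?_⟩
    refine ((Real.continuous_exp.tendsto _).comp (hsub.tendsto_lim hbdd).neg).congr fun n => ?_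
    rw [Function.comp_apply, Real.rpow_def_of_pos (hpow n)]
    congr 1
    ring

/-- Along the multiples `n * k`, supermultiplicativity keeps the roots above `κ(S^n)^(1/n)`. -/
theorem one_lt_injRadius_of_one_lt_injModulus_pow [Nontrivial X] {S : X →L[ℂ] X} {n : ℕ}
    (hn : 0 < n) (h : 1 < injModulus (S ^ n)) : 1 < injRadius S := by
  have hn' : (0 : ℝ) < n := by exact_mod_cast hn
  refine (Real.one_lt_rpow h (by positivity : 0 < 1 / (n : ℝ))).trans_le ?_
  have hsub : Tendsto (fun k : ℕ => n * k) atTop atTop :=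
    tendsto_id.const_mul_atTop' hn
  refine ge_of_tendsto ((tendsto_injRadius S).comp hsub) ?_
  filter_upwards [eventually_gt_atTop 0] with k hk
  have hk' : (0 : ℝ) < k := by exact_mod_cast hk
  rw [Function.comp_apply, pow_mul]
  calc injModulus (S ^ n) ^ (1 / (n : ℝ))
      = (injModulus (S ^ n) ^ k) ^ (1 / ((n * k : ℕ) : ℝ)) := by
        rw [← Real.rpow_natCast, ← Real.rpow_mul (injModulus_nonneg _)]
        congr 1
        push_cast
        field_simp
    _ ≤ _ := Real.rpow_le_rpow (pow_nonneg (injModulus_nonneg _) _) (pow_injModulus_le _ _)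
        (by positivity)

theorem exists_one_lt_pow_le_injModulus [Nontrivial X] {S : X →L[ℂ] X} (h : 1 < injRadius S) :
    ∃ r : ℝ, 1 < r ∧ ∀ᶠ n : ℕ in atTop, r ^ n ≤ injModulus (S ^ n) := by
  obtain ⟨r, hr1, hr⟩ := exists_between h
  refine ⟨r, hr1, ?_⟩
  filter_upwards [(tendsto_injRadius S).eventually (lt_mem_nhds hr), eventually_gt_atTop 0]
    with n hn hn0
  have hn' : (n : ℝ) ≠ 0 := by exact_mod_cast hn0.ne'
  calc r ^ n ≤ (injModulus (S ^ n) ^ (1 / (n : ℝ))) ^ n :=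
        pow_le_pow_left₀ (zero_le_one.trans hr1.le) hn.le n
    _ = injModulus (S ^ n) := by
        rw [← Real.rpow_natCast, ← Real.rpow_mul (injModulus_nonneg _), one_div,
          inv_mul_cancel₀ hn', Real.rpow_one]

end InjModulus

/-! ### From a uniform lower bound on the disc to exponential growth -/

section Growth

/-- A discrete Cauchy formula: the character sum keeps only the pairs with `i + j = N`. There are `N
+ 1` of them, so squaring the geometric sum gains a factor `N + 1` over the number of terms in the
average. -/
theorem sum_rootsOfUnity_smul_geom_sum_sq {A : Type*} [Ring A] [Algebra ℂ A] (a : A) (μ ζ : ℂ)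
    (N : ℕ) (hζ : IsPrimitiveRoot ζ (N + 1)) :
    ∑ t ∈ Finset.range (N + 1), ζ ^ t •
      ((∑ i ∈ Finset.range (N + 1), a ^ i * algebraMap ℂ A (ζ ^ t * μ) ^ (N - i)) *
        ∑ i ∈ Finset.range (N + 1), a ^ i * algebraMap ℂ A (ζ ^ t * μ) ^ (N - i)) =
      (((N : ℂ) + 1) ^ 2 * μ ^ N) • a ^ N := by
  have hgeom : ∀ d, d ≤ 2 * N → ∑ t ∈ Finset.range (N + 1), (ζ ^ (d + 1)) ^ t =
      if d = N then ((N : ℂ) + 1) else 0 := by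
    intro d hd
    split_ifs with h
    · subst h; simp [hζ.pow_eq_one]
    · have hne : ζ ^ (d + 1) ≠ 1 := by
        intro h1
        obtain ⟨k, hk⟩ := hζ.dvd_of_pow_eq_one _ h1
        -- Since `d + 1 ≤ 2 * N + 1`, the only possible multiple of `N + 1` is `N + 1` itself.
        have : k < 2 := by
          by_contra! h2
          have := Nat.mul_le_mul_left (N + 1) h2
          omega
        interval_cases k <;> omega
      rw [geom_sum_eq hne, ← pow_mul, mul_comm, pow_mul, hζ.pow_eq_one]
      simp
  have hflip : ∀ t : ℕ, ∑ i ∈ Finset.range (N + 1), a ^ i * algebraMap ℂ A (ζ ^ t * μ) ^ (N - i) =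
      ∑ i ∈ Finset.range (N + 1), (ζ ^ t * μ) ^ i • a ^ (N - i) := by
    intro t
    rw [← Finset.sum_range_reflect]
    refine Finset.sum_congr rfl fun i hi => ?_
    have hi' : N + 1 - 1 - i = N - i := by omega
    have hi2 : N - (N - i) = i := by have := Finset.mem_range.1 hi; omega
    rw [hi', hi2, ← map_pow, ← Algebra.commutes, Algebra.smul_def]
  simp_rw [hflip, Finset.sum_mul_sum, smul_mul_smul_comm, ← pow_add, Finset.smul_sum, smul_smul]
  rw [Finset.sum_comm]
  have hinner : ∀ i ∈ Finset.range (N + 1), ∑ t ∈ Finset.range (N + 1),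
      ∑ j ∈ Finset.range (N + 1), (ζ ^ t * (ζ ^ t * μ) ^ (i + j)) • a ^ (N - i + (N - j)) =
      (((N : ℂ) + 1) * μ ^ N) • a ^ N := by
    intro i hi
    have hiN : i ≤ N := Nat.lt_succ_iff.1 (Finset.mem_range.1 hi)
    rw [Finset.sum_comm, Finset.sum_eq_single (N - i)]
    · rw [← Finset.sum_smul]
      have h1 : i + (N - i) = N := by omega
      have h2 : N - i + (N - (N - i)) = N := by omega
      rw [h2, h1]
      congr 1
      rw [← if_pos (rfl : N = N) (t := (N : ℂ) + 1) (e := 0), ← hgeom N (by omega),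
        Finset.sum_mul]
      refine Finset.sum_congr rfl fun t _ => ?_
      ring
    · intro j hj hne
      have hjN : j ≤ N := Nat.lt_succ_iff.1 (Finset.mem_range.1 hj)
      rw [← Finset.sum_smul]
      have : ∑ t ∈ Finset.range (N + 1), ζ ^ t * (ζ ^ t * μ) ^ (i + j) =
          (∑ t ∈ Finset.range (N + 1), (ζ ^ (i + j + 1)) ^ t) * μ ^ (i + j) := by
        rw [Finset.sum_mul]
        refine Finset.sum_congr rfl fun t _ => ?_
        ring
      rw [this, hgeom _ (by omega), if_neg (by omega), zero_mul, zero_smul]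
    · intro h
      exact absurd (Finset.mem_range.2 (by omega)) h
  rw [Finset.sum_congr rfl hinner, Finset.sum_const, Finset.card_range, ← Nat.cast_smul_eq_nsmul ℂ,
    smul_smul]
  congr 1
  push_cast
  ring

variable {X : Type*} [NormedAddCommGroup X] [NormedSpace ℂ X]

/-- With `D = S - z`, `z = ζ ^ t * μ` and `Q = S^(N+1) - μ^(N+1)`, one has `D G(z) = Q`, so `D²
G(z)² = Q²` and `c² ‖G(z)² x‖ ≤ ‖Q² x‖`. Averaging over `t` isolates `S^N x`; the right side bounds
`‖Q² x‖`. -/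
theorem norm_pow_apply_le_of_bddBelow {S : X →L[ℂ] X} {c : ℝ} (hc : 0 < c)
    (h : ∀ z : ℂ, ‖z‖ ≤ 1 → ∀ x, c * ‖x‖ ≤ ‖S x - z • x‖) (N : ℕ) {μ : ℂ} (hμ : ‖μ‖ ≤ 1) (x : X) :
    c ^ 2 * (N + 1) * ‖μ‖ ^ N * ‖(S ^ N) x‖ ≤
      ‖(S ^ (N + 1) * S ^ (N + 1)) x‖ + 2 * ‖μ‖ ^ (N + 1) * ‖(S ^ (N + 1)) x‖ +
        (‖μ‖ ^ (N + 1)) ^ 2 * ‖x‖ := by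
  have hζ := Complex.isPrimitiveRoot_exp (N + 1) N.succ_ne_zero
  set ζ : ℂ := Complex.exp (2 * Real.pi * Complex.I / ((N + 1 : ℕ) : ℂ)) with hζdef
  have hζn : ‖ζ‖ = 1 := hζ.norm'_eq_one N.succ_ne_zero
  set Q := (S ^ (N + 1) - algebraMap ℂ (X →L[ℂ] X) (μ ^ (N + 1))) with hQ
  let G : ℂ → (X →L[ℂ] X) := fun z =>
    ∑ i ∈ Finset.range (N + 1), S ^ i * algebraMap ℂ (X →L[ℂ] X) z ^ (N - i)
  have hG : ∀ t : ℕ, (S - algebraMap ℂ (X →L[ℂ] X) (ζ ^ t * μ)) * G (ζ ^ t * μ) = Q := by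
    intro t
    have := (Algebra.commutes (ζ ^ t * μ) S).symm
    have h2 := Commute.mul_geom_sum₂ (x := S) (y := algebraMap ℂ (X →L[ℂ] X) (ζ ^ t * μ)) this (N + 1)
    simp only [Nat.add_sub_cancel] at h2
    rw [hQ, h2, ← map_pow, mul_pow, ← pow_mul, mul_comm t, pow_mul, hζ.pow_eq_one, one_pow, one_mul]
  have hbound : ∀ t : ℕ, c ^ 2 * ‖(G (ζ ^ t * μ) * G (ζ ^ t * μ)) x‖ ≤ ‖(Q * Q) x‖ := by
    intro t
    set z := ζ ^ t * μ with hz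
    have hz1 : ‖z‖ ≤ 1 := by rw [hz, norm_mul, norm_pow, hζn, one_pow, one_mul]; exact hμ
    set D := S - algebraMap ℂ (X →L[ℂ] X) z with hD
    have hDx : ∀ v, c * ‖v‖ ≤ ‖D v‖ := fun v => by
      have := h z hz1 v
      simpa [hD, Algebra.algebraMap_eq_smul_one] using this
    have hcomm : D * Q = Q * D := by
      have h1 : Commute S (algebraMap ℂ (X →L[ℂ] X) z) := (Algebra.commutes z S).symm
      have h2 : Commute S Q :=
        ((Commute.refl S).pow_right _).sub_right (Algebra.commutes _ S).symm
      exact h2.sub_left (Algebra.commutes z Q)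
    have hmul : D * (D * (G z * G z)) = Q * Q := by
      rw [← mul_assoc D (G z), hG t, ← mul_assoc, hcomm, mul_assoc, hG t]
    calc c ^ 2 * ‖(G z * G z) x‖ = c * (c * ‖(G z * G z) x‖) := by ring
      _ ≤ c * ‖D ((G z * G z) x)‖ := by gcongr; exact hDx _
      _ ≤ ‖D (D ((G z * G z) x))‖ := hDx _
      _ = ‖(Q * Q) x‖ := by rw [← hmul]; rfl
  have hsum := congrArg (fun A : X →L[ℂ] X => A x) (sum_rootsOfUnity_smul_geom_sum_sq S μ ζ N hζ)
  have hN : (0 : ℝ) < N + 1 := by positivity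
  have hle : c ^ 2 * ((N + 1) ^ 2 * ‖μ‖ ^ N * ‖(S ^ N) x‖) ≤ (N + 1) * ‖(Q * Q) x‖ := by
    calc c ^ 2 * ((N + 1) ^ 2 * ‖μ‖ ^ N * ‖(S ^ N) x‖)
        = c ^ 2 * ‖((((N : ℂ) + 1) ^ 2 * μ ^ N) • S ^ N) x‖ := by
          have h1 : ‖(N : ℂ) + 1‖ = N + 1 := by
            rw [← Nat.cast_succ, Complex.norm_natCast, Nat.cast_succ]
          rw [smul_apply, norm_smul, norm_mul, norm_pow, norm_pow, h1]
      _ = c ^ 2 * ‖∑ t ∈ Finset.range (N + 1), ζ ^ t • (G (ζ ^ t * μ) * G (ζ ^ t * μ)) x‖ := by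
          rw [← hsum, sum_apply]
          rfl
      _ ≤ c ^ 2 * ∑ t ∈ Finset.range (N + 1), ‖(G (ζ ^ t * μ) * G (ζ ^ t * μ)) x‖ := by
          gcongr
          refine (norm_sum_le _ _).trans (Finset.sum_le_sum fun t _ => ?_)
          rw [norm_smul, norm_pow, hζn, one_pow, one_mul]
      _ ≤ ∑ t ∈ Finset.range (N + 1), ‖(Q * Q) x‖ := by
          rw [Finset.mul_sum]
          exact Finset.sum_le_sum fun t _ => hbound t
      _ = (N + 1) * ‖(Q * Q) x‖ := by simp
  have hle' : c ^ 2 * (N + 1) * ‖μ‖ ^ N * ‖(S ^ N) x‖ ≤ ‖(Q * Q) x‖ := by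
    refine le_of_mul_le_mul_left ?_ hN
    calc _ = c ^ 2 * ((N + 1) ^ 2 * ‖μ‖ ^ N * ‖(S ^ N) x‖) := by ring
      _ ≤ _ := hle
  refine hle'.trans ?_
  have hQQ : (Q * Q) x = (S ^ (N + 1) * S ^ (N + 1)) x - (2 * μ ^ (N + 1)) • (S ^ (N + 1)) x +
      (μ ^ (N + 1)) ^ 2 • x := by
    have hq : ∀ v, Q v = (S ^ (N + 1)) v - μ ^ (N + 1) • v := fun v => by
      simp [hQ, Algebra.algebraMap_eq_smul_one]
    rw [mul_apply_eq_comp, hq, hq, map_sub, map_smul, mul_apply_eq_comp]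
    module
  rw [hQQ]
  refine (norm_add_le _ _).trans (add_le_add ((norm_sub_le _ _).trans_eq ?_) ?_)
  · simp [norm_smul]
  · simp [norm_smul]

/-- The ratio `‖A^(j+1) x‖ / ‖A^j x‖` is at least tripled until it reaches `3`, and stays at least
`3` afterwards. The time `J` needed depends on `q` only, not on `x`. -/
theorem exists_growth_of_step {A : X →L[ℂ] X} {q : ℝ} (hq : 0 < q)
    (h0 : ∀ x, q * ‖x‖ ≤ ‖A x‖)
    (hstep : ∀ x p, 0 ≤ p → p * ‖x‖ ≤ ‖A x‖ → 3 * min p 1 * ‖A x‖ ≤ ‖A (A x)‖) :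
    ∃ J : ℕ, ∀ j x, 3 ^ j * q ^ J * ‖x‖ ≤ ‖(A ^ (J + j)) x‖ := by
  have key : ∀ j x, min (3 ^ j * q) 3 * ‖(A ^ j) x‖ ≤ ‖(A ^ (j + 1)) x‖ := by
    intro j x
    induction j with
    | zero =>
      refine le_trans ?_ (by simpa using h0 x)
      simpa using mul_le_mul_of_nonneg_right (min_le_left q 3) (norm_nonneg x)
    | succ j ih =>
      have e : ∀ k, (A ^ (k + 1)) x = A ((A ^ k) x) := fun k => by rw [pow_succ']; rfl
      rw [e] at ih
      have := hstep _ _ (by positivity) ih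
      rw [e (j + 1), e j]
      refine le_trans ?_ this
      gcongr
      have h3 : (3 : ℝ) ^ (j + 1) * q = 3 * (3 ^ j * q) := by ring
      rw [h3]
      rcases min_cases (3 ^ j * q) 3 with ⟨h, h'⟩ | ⟨h, h'⟩ <;> rw [h]
      · rw [mul_min_of_nonneg _ _ (by norm_num : (0 : ℝ) ≤ 3), mul_one]
      · norm_num
  obtain ⟨J, hJ⟩ := pow_unbounded_of_one_lt (3 / q) (by norm_num : (1 : ℝ) < 3)
  rw [div_lt_iff₀ hq] at hJ
  refine ⟨J, fun j x => ?_⟩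
  induction j with
  | zero =>
    have : ∀ k, q ^ k * ‖x‖ ≤ ‖(A ^ k) x‖ := by
      intro k
      induction k with
      | zero => simp
      | succ k ih =>
        calc q ^ (k + 1) * ‖x‖ = q * (q ^ k * ‖x‖) := by ring
          _ ≤ q * ‖(A ^ k) x‖ := by gcongr
          _ ≤ ‖A ((A ^ k) x)‖ := h0 _
          _ = ‖(A ^ (k + 1)) x‖ := by rw [pow_succ']; rfl
    simpa using this J
  | succ j ih =>
    have h1 := key (J + j) x
    rw [min_eq_right] at h1
    · calc 3 ^ (j + 1) * q ^ J * ‖x‖ = 3 * (3 ^ j * q ^ J * ‖x‖) := by ring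
        _ ≤ 3 * ‖(A ^ (J + j)) x‖ := by gcongr
        _ ≤ _ := h1
    · rw [pow_add]
      have : (1 : ℝ) ≤ 3 ^ j := one_le_pow₀ (by norm_num)
      nlinarith

/-- If `S - z` is bounded below uniformly for `z` in the closed unit disc, then `i(S) > 1`. -/
theorem one_lt_injRadius_of_bddBelow [Nontrivial X] {S : X →L[ℂ] X} {c : ℝ} (hc : 0 < c)
    (h : ∀ z : ℂ, ‖z‖ ≤ 1 → ∀ x, c * ‖x‖ ≤ ‖S x - z • x‖) : 1 < injRadius S := by
  have hS0 : ∀ x, c * ‖x‖ ≤ ‖S x‖ := fun x => by simpa using h 0 (by simp) x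
  have hκ : 0 < injModulus S := hc.trans_le (le_injModulus hS0)
  have hSn : 0 < ‖S‖ := hκ.trans_le (injModulus_le_norm S)
  -- The constant `6` leaves `4` after absorbing the cross term `2R‖Ax‖`, and `3` after bounding
  -- `R²‖x‖` by `R‖Ax‖` with `R = min p 1`.
  obtain ⟨N, hN⟩ := exists_nat_gt (6 * ‖S‖ / c ^ 2)
  rw [div_lt_iff₀ (by positivity)] at hN
  set A := S ^ (N + 1) with hA
  have hq : 0 < injModulus A := (pow_pos hκ _).trans_le (pow_injModulus_le S _)
  have hmain : ∀ (x : X) (R : ℝ), 0 ≤ R → R ≤ 1 →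
      4 * (R * ‖A x‖) ≤ ‖A (A x)‖ + R ^ 2 * ‖x‖ := by
    intro x R hR0 hR1
    -- Taking `μ = r` makes `μ^(N+1) = R`, and `r ≤ 1` gives `R ≤ r^N`.
    set r := R ^ (1 / ((N + 1 : ℕ) : ℝ)) with hr
    have hr0 : 0 ≤ r := Real.rpow_nonneg hR0 _
    have hr1 : r ≤ 1 := Real.rpow_le_one hR0 hR1 (by positivity)
    have hrR : r ^ (N + 1) = R := by
      rw [hr, one_div]; exact Real.rpow_inv_natCast_pow hR0 N.succ_ne_zero
    have hnr : ‖(r : ℂ)‖ = r := by rw [Complex.norm_real, Real.norm_of_nonneg hr0]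
    have h1 := norm_pow_apply_le_of_bddBelow hc h N (μ := r) (by rw [hnr]; exact hr1) x
    rw [hnr, hrR, ← hA, mul_apply_eq_comp] at h1
    have h2 : ‖A x‖ ≤ ‖S‖ * ‖(S ^ N) x‖ := by
      rw [hA, pow_succ']; exact S.le_opNorm _
    have h3 : R ≤ r ^ N := by rw [← hrR]; exact pow_le_pow_of_le_one hr0 hr1 N.le_succ
    have h4 : 6 * (R * ‖A x‖) ≤ c ^ 2 * (N + 1) * r ^ N * ‖(S ^ N) x‖ :=
      calc 6 * (R * ‖A x‖) ≤ 6 * (r ^ N * (‖S‖ * ‖(S ^ N) x‖)) := by gcongr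
        _ = 6 * ‖S‖ * (r ^ N * ‖(S ^ N) x‖) := by ring
        _ ≤ (c ^ 2 * (N + 1)) * (r ^ N * ‖(S ^ N) x‖) :=
          mul_le_mul_of_nonneg_right (by nlinarith) (by positivity)
        _ = _ := by ring
    linarith
  obtain ⟨J, hJ⟩ := exists_growth_of_step hq (injModulus_mul_norm_le A) (by
    intro x p hp hpx
    have hR0 : 0 ≤ min p 1 := le_min hp zero_le_one
    have h1 := hmain x _ hR0 (min_le_right _ _)
    have h2 : min p 1 * ‖x‖ ≤ ‖A x‖ :=
      (mul_le_mul_of_nonneg_right (min_le_left _ _) (norm_nonneg _)).trans hpx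
    have h3 := mul_le_mul_of_nonneg_left h2 hR0
    nlinarith)
  obtain ⟨j, hj⟩ := pow_unbounded_of_one_lt (1 / injModulus A ^ J) (by norm_num : (1 : ℝ) < 3)
  rw [div_lt_iff₀ (by positivity)] at hj
  -- Using `j + 1` keeps the exponent positive even if `J = j = 0`.
  have hpos : 0 < J + (j + 1) := by omega
  refine one_lt_injRadius_of_one_lt_injModulus_pow (n := (N + 1) * (J + (j + 1))) (by positivity) ?_
  rw [pow_mul, ← hA]
  refine lt_of_lt_of_le ?_ (le_injModulus (hJ (j + 1)))
  rw [pow_succ]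
  nlinarith

end Growth

/-! ### Duality, invertibility and solving `T^n u = y` -/

section Duality

variable {X Y : Type*} [NormedAddCommGroup X] [NormedSpace ℂ X] [NormedAddCommGroup Y]
  [NormedSpace ℂ Y]

theorem exists_dual_comp_eq_zero {A : X →L[ℂ] X} (h : ¬ DenseRange A) :
    ∃ f : StrongDual ℂ X, f ≠ 0 ∧ ∀ x, f (A x) = 0 := by
  set M := (LinearMap.range (A : X →ₗ[ℂ] X)).topologicalClosure with hM
  obtain ⟨x, hx⟩ : ∃ x, x ∉ M := by
    by_contra! hall
    refine h fun x => ?_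
    have := hall x
    rw [hM, ← SetLike.mem_coe, Submodule.topologicalClosure_coe] at this
    exact this
  have : IsClosed (M : Set X) := Submodule.isClosed_topologicalClosure _
  have hne : M.mkQL x ≠ 0 := by simpa using hx
  obtain ⟨g, hg⟩ := SeparatingDual.exists_ne_zero (R := ℂ) hne
  refine ⟨g.comp M.mkQL, fun h0 => hg (by simpa using congrArg (fun f => f x) h0), fun y => ?_⟩
  have hy : A y ∈ M := Submodule.le_topologicalClosure _ ⟨y, rfl⟩
  have : M.mkQL (A y) = 0 := by simpa using hy
  rw [ContinuousLinearMap.comp_apply, this, map_zero]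

theorem bijective_of_bddBelow_of_denseRange [CompleteSpace X] {A : X →L[ℂ] X} {c : ℝ} (hc : 0 < c)
    (hA : ∀ x, c * ‖x‖ ≤ ‖A x‖) (hd : DenseRange A) : Function.Bijective A := by
  have hanti : AntilipschitzWith (Real.toNNReal c)⁻¹ A := by
    refine A.antilipschitz_of_bound fun x => ?_
    rw [NNReal.coe_inv, Real.coe_toNNReal _ hc.le, inv_mul_eq_div, le_div_iff₀ hc, mul_comm]
    exact hA x
  refine ⟨hanti.injective, Set.range_eq_univ.1 ?_⟩
  rw [← (hanti.isClosed_range A.uniformContinuous).closure_eq]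
  exact hd.closure_range

/-- If `S - z` is bounded below uniformly for `z` in the closed unit disc, then invertibility of
`S - z` does not depend on the choice of `z` in that disc. -/
theorem isUnit_sub_of_bddBelow [CompleteSpace X] [Nontrivial X] {S : X →L[ℂ] X} {c : ℝ} (hc : 0 < c)
    (h : ∀ z : ℂ, ‖z‖ ≤ 1 → ∀ x, c * ‖x‖ ≤ ‖S x - z • x‖) {z w : ℂ} (hz : ‖z‖ ≤ 1) (hw : ‖w‖ ≤ 1)
    (hu : IsUnit (S - algebraMap ℂ (X →L[ℂ] X) z)) :
    IsUnit (S - algebraMap ℂ (X →L[ℂ] X) w) := by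
  set U : Set ℂ := {z | IsUnit (S - algebraMap ℂ (X →L[ℂ] X) z)} with hU
  have hUo : IsOpen U :=
    Units.isOpen.preimage (continuous_const.sub (algebraMapCLM ℂ (X →L[ℂ] X)).continuous)
  have hball : IsPreconnected (Metric.closedBall (0 : ℂ) 1) :=
    (convex_closedBall 0 1).isPreconnected
  -- The invertibility set is open. It is also closed in the disc: for `b` within `c/3` of `a`, `S -
  -- b` is bounded below by `2c/3`, so its inverse is small enough for the invertibility to pass to
  -- `S - a`.
  refine hball.subset_of_closure_inter_subset hUo ⟨z, by simpa using hz, hu⟩ ?_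
    (by simpa using hw)
  rintro a ⟨hacl, ha⟩
  obtain ⟨b, hbU, hab⟩ := Metric.mem_closure_iff.1 hacl (c / 3) (by positivity)
  obtain ⟨V, hV⟩ : IsUnit (S - algebraMap ℂ (X →L[ℂ] X) b) := hbU
  have hVx : ∀ x, 2 * c / 3 * ‖x‖ ≤ ‖(V : X →L[ℂ] X) x‖ := by
    intro x
    have h1 := h a (by simpa using ha) x
    have h2 : S x - a • x = (V : X →L[ℂ] X) x - (a - b) • x := by
      rw [hV]
      simp only [sub_apply, Algebra.algebraMap_eq_smul_one,
        smul_apply, one_apply_eq_self]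
      module
    rw [h2] at h1
    have h3 := h1.trans (norm_sub_le _ _)
    rw [norm_smul, ← dist_eq_norm] at h3
    have h4 := mul_le_mul_of_nonneg_right hab.le (norm_nonneg x)
    linarith
  have hinv : ‖(↑V⁻¹ : X →L[ℂ] X)‖ ≤ (2 * c / 3)⁻¹ := by
    refine ContinuousLinearMap.opNorm_le_bound _ (by positivity) fun x => ?_
    have h1 := hVx ((↑V⁻¹ : X →L[ℂ] X) x)
    have h2 : (V : X →L[ℂ] X) ((↑V⁻¹ : X →L[ℂ] X) x) = x := by
      rw [← mul_apply_eq_comp, Units.mul_inv, one_apply_eq_self]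
    rw [h2] at h1
    rw [inv_mul_eq_div, le_div_iff₀ (by positivity), mul_comm]
    exact h1
  refine (V.ofNearby (S - algebraMap ℂ (X →L[ℂ] X) a) ?_).isUnit
  have hpos : 0 < ‖(↑V⁻¹ : X →L[ℂ] X)‖ := Units.norm_pos _
  refine lt_of_lt_of_le ?_ ((le_inv_comm₀ hpos (by positivity)).1 hinv)
  rw [hV, sub_sub_sub_cancel_left, ← map_sub, norm_algebraMap', ← dist_eq_norm, dist_comm]
  linarith

variable (e : Y ≃ₗᵢ[ℂ] StrongDual ℂ X)

section Adjoint

variable {A : X →L[ℂ] X} {B : Y →L[ℂ] Y} (hAB : ∀ y x, e (B y) x = e y (A x))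
include hAB

theorem dual_pow_apply (n : ℕ) (y : Y) (x : X) : e ((B ^ n) y) x = e y ((A ^ n) x) := by
  induction n generalizing x with
  | zero => rfl
  | succ n ih =>
    rw [pow_succ', pow_succ, mul_apply_eq_comp,
      mul_apply_eq_comp, hAB, ih]

theorem dual_sub_algebraMap_apply (z : ℂ) (y : Y) (x : X) :
    e ((B - algebraMap ℂ (Y →L[ℂ] Y) z) y) x = e y ((A - algebraMap ℂ (X →L[ℂ] X) z) x) := by
  simp [Algebra.algebraMap_eq_smul_one, hAB]

/-- The functional `y ∘ A⁻¹` on the range of `A` has norm at most `‖y‖ / c`; a Hahn-Banach extension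
of it is the preimage. -/
theorem exists_preimage_of_bddBelow {c : ℝ} (hc : 0 < c) (hA : ∀ x, c * ‖x‖ ≤ ‖A x‖) (y : Y) :
    ∃ u, B u = y ∧ ‖u‖ ≤ ‖y‖ / c := by
  have hinj : Function.Injective (A : X →ₗ[ℂ] X) := by
    refine (injective_iff_map_eq_zero _).2 fun x hx => ?_
    have h1 := hA x
    rw [show A x = 0 from hx, norm_zero] at h1
    exact norm_le_zero_iff.1 (nonpos_of_mul_nonpos_right h1 hc)
  let E := LinearEquiv.ofInjective (A : X →ₗ[ℂ] X) hinj
  let g : StrongDual ℂ (LinearMap.range (A : X →ₗ[ℂ] X)) :=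
    LinearMap.mkContinuous ((e y : X →ₗ[ℂ] ℂ) ∘ₗ E.symm.toLinearMap) (‖y‖ / c) (by
      intro v
      obtain ⟨x, rfl⟩ := E.surjective v
      have h1 : ‖e y x‖ ≤ ‖y‖ * ‖x‖ := by
        simpa using (e y).le_opNorm x
      have h2 : ‖x‖ ≤ ‖A x‖ / c := by rw [le_div_iff₀ hc, mul_comm]; exact hA x
      calc ‖((e y : X →ₗ[ℂ] ℂ) ∘ₗ E.symm.toLinearMap) (E x)‖ = ‖e y x‖ := by simp
        _ ≤ ‖y‖ * (‖A x‖ / c) := h1.trans (by gcongr)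
        _ = ‖y‖ / c * ‖E x‖ := by
          rw [show ‖E x‖ = ‖A x‖ from rfl]; ring)
  obtain ⟨f, hf, hfn⟩ := exists_extension_norm_eq _ g
  refine ⟨e.symm f, e.injective ?_, ?_⟩
  · ext x
    rw [hAB, e.apply_symm_apply]
    have h1 : f (A x) = g (E x) := hf (E x)
    rw [h1]
    simp [g]
  · rw [LinearIsometryEquiv.norm_map, hfn]
    exact LinearMap.mkContinuous_norm_le _ (by positivity) _

theorem dual_injective_of_denseRange (hd : DenseRange A) : Function.Injective B := by
  refine (injective_iff_map_eq_zero _).2 fun y hy => e.injective ?_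
  rw [map_zero]
  have h1 : (e y : X → ℂ) = (0 : StrongDual ℂ X) := by
    refine hd.equalizer (e y).continuous continuous_const (funext fun x => ?_)
    simp [← hAB, hy]
  exact DFunLike.coe_injective h1

theorem denseRange_of_dual_injective (hB : Function.Injective B) : DenseRange A := by
  by_contra hd
  obtain ⟨f, hf0, hf⟩ := exists_dual_comp_eq_zero hd
  refine hf0 ?_
  have : B (e.symm f) = 0 := e.injective (by ext x; simp [hAB, hf])
  have := hB (this.trans (map_zero B).symm)
  simpa using this

theorem isUnit_dual_of_isUnit [CompleteSpace X] [CompleteSpace Y] {c : ℝ} (hc : 0 < c)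
    (hA : ∀ x, c * ‖x‖ ≤ ‖A x‖) (hu : IsUnit A) : IsUnit B := by
  rw [ContinuousLinearMap.isUnit_iff_bijective] at hu ⊢
  refine ⟨dual_injective_of_denseRange e hAB hu.2.denseRange, fun y => ?_⟩
  obtain ⟨u, hu, -⟩ := exists_preimage_of_bddBelow e hAB hc hA y
  exact ⟨u, hu⟩

theorem isUnit_of_isUnit_dual [CompleteSpace X] [CompleteSpace Y] {c : ℝ} (hc : 0 < c)
    (hA : ∀ x, c * ‖x‖ ≤ ‖A x‖) (hu : IsUnit B) : IsUnit A := by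
  rw [ContinuousLinearMap.isUnit_iff_bijective] at hu ⊢
  exact bijective_of_bddBelow_of_denseRange hc hA (denseRange_of_dual_injective e hAB hu.1)

end Adjoint

variable {S : X →L[ℂ] X} {T : Y →L[ℂ] Y} (hST : ∀ y x, e (T y) x = e y (S x))
include hST

theorem exists_one_lt_eventually_preimage [Nontrivial X] (h : 1 < injRadius S) :
    ∃ r : ℝ, 1 < r ∧ ∀ᶠ n : ℕ in atTop, ∀ y, ∃ u, (T ^ n) u = y ∧ ‖u‖ ≤ ‖y‖ / r ^ n := by
  obtain ⟨r, hr, hn⟩ := exists_one_lt_pow_le_injModulus h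
  refine ⟨r, hr, hn.mono fun n hn y => ?_⟩
  exact exists_preimage_of_bddBelow e (dual_pow_apply e hST n) (by positivity)
    (fun x => (mul_le_mul_of_nonneg_right hn (norm_nonneg x)).trans (injModulus_mul_norm_le _ x)) y

theorem JMixSet_eq_univ_of_mem_ker [Nontrivial X] (h : 1 < injRadius S) {x : Y} (hx : T x = 0) :
    JMixSet T x = Set.univ := by
  refine Set.eq_univ_of_forall fun y => ?_
  obtain ⟨r, hr, hev⟩ := exists_one_lt_eventually_preimage e hST h
  -- Preimages are only available for large `n`; elsewhere the choice defaults to `0`.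
  have hex : ∀ n, ∃ u, (∀ y, ∃ u, (T ^ n) u = y ∧ ‖u‖ ≤ ‖y‖ / r ^ n) →
      (T ^ n) u = y ∧ ‖u‖ ≤ ‖y‖ / r ^ n := fun n => by
    by_cases hn : ∀ y, ∃ u, (T ^ n) u = y ∧ ‖u‖ ≤ ‖y‖ / r ^ n
    · exact (hn y).imp fun u hu _ => hu
    · exact ⟨0, fun h => absurd h hn⟩
  choose u hu using hex
  have hu' : ∀ᶠ n in atTop, (T ^ n) (u n) = y ∧ ‖u n‖ ≤ ‖y‖ / r ^ n := by
    filter_upwards [hev] with n hn using hu n hn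
  refine ⟨fun n => x + u n, ?_, ?_⟩
  · have h0 : Tendsto u atTop (𝓝 0) :=
      squeeze_zero_norm' (hu'.mono fun n hn => hn.2)
        (tendsto_const_nhds.div_atTop (tendsto_pow_atTop_atTop_of_one_lt hr))
    simpa using h0.const_add x
  · refine tendsto_const_nhds.congr' ?_
    filter_upwards [hu', eventually_ge_atTop 1] with n hn hn1
    obtain ⟨m, rfl⟩ := Nat.exists_eq_add_of_le' hn1
    have hx0 : (T ^ (m + 1)) x = 0 := by
      rw [pow_succ, mul_apply_eq_comp, hx, map_zero]
    rw [map_add, hx0, hn.1, zero_add]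

/-- By injectivity `u n` is the small preimage of `T^(k n) (u n)`. These images converge, so `u n →
0`. -/
theorem eq_zero_of_mem_JSet_of_injective [Nontrivial X] (h : 1 < injRadius S)
    (hinj : Function.Injective T) {x y : Y} (hy : y ∈ JSet T x) : x = 0 := by
  obtain ⟨k, hk, u, hu, hTu⟩ := hy
  obtain ⟨r, hr, hev⟩ := exists_one_lt_eventually_preimage e hST h
  have hle : ∀ᶠ n in atTop, ‖u n‖ ≤ ‖(T ^ k n) (u n)‖ / r ^ k n := by
    filter_upwards [hk.tendsto_atTop.eventually hev] with n hn
    obtain ⟨v, hv, hvn⟩ := hn ((T ^ k n) (u n))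
    have hpow : Function.Injective (T ^ k n) := by
      rw [FunLike.coe_pow_eq_iterate]
      exact hinj.iterate _
    rwa [hpow hv] at hvn
  have h0 : Tendsto u atTop (𝓝 0) :=
    squeeze_zero_norm' hle (hTu.norm.div_atTop
      ((tendsto_pow_atTop_atTop_of_one_lt hr).comp hk.tendsto_atTop))
  exact tendsto_nhds_unique hu h0

end Duality

/-! ### Eigenvalues of the adjoint and `J`-sets -/

section PointSpectrum

variable {Y : Type*} [NormedAddCommGroup Y] [NormedSpace ℂ Y]

theorem mem_pointSpectrum_iff {T : Y →L[ℂ] Y} {z : ℂ} :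
    z ∈ pointSpectrum T ↔ ∃ y, y ≠ 0 ∧ T y = z • y := by
  constructor
  · intro h
    obtain ⟨y, hy⟩ := Module.End.HasEigenvalue.exists_hasEigenvector h
    exact ⟨y, hy.2, hy.apply_eq_smul⟩
  · rintro ⟨y, hy, h⟩
    exact Module.End.hasEigenvalue_of_hasEigenvector (x := y)
      ⟨Module.End.mem_eigenspace_iff.2 h, hy⟩

/-- If `T* f = z f`, then `f (T^n u) = z^n f u`. So `|f|` is constant on the `J`-set: `0` if `|z| <
1`, `|f x|` if `|z| = 1`. But `f ≠ 0` is an open map, and a circle has empty interior. -/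
theorem pointSpectrum_banachAdjoint_inter_closedBall {T : Y →L[ℂ] Y} {x : Y}
    (h : (interior (JSet T x)).Nonempty) :
    pointSpectrum (banachAdjoint T) ∩ Metric.closedBall (0 : ℂ) 1 = ∅ := by
  refine Set.eq_empty_of_forall_notMem ?_
  rintro z ⟨hz, hz1⟩
  rw [mem_closedBall_zero_iff] at hz1
  obtain ⟨f, hf0, hf⟩ := mem_pointSpectrum_iff.1 hz
  have hfT : ∀ y, f (T y) = z * f y := fun y =>
    congrArg (fun g : StrongDual ℂ Y => g y) hf
  have hpow : ∀ n y, f ((T ^ n) y) = z ^ n * f y := by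
    intro n y
    induction n with
    | zero => simp
    | succ n ih => rw [pow_succ', mul_apply_eq_comp, hfT, ih]; ring
  obtain ⟨R, hR⟩ : ∃ R, ∀ y ∈ JSet T x, ‖f y‖ = R := by
    rcases hz1.lt_or_eq with hlt | heq
    · refine ⟨0, fun y hy => ?_⟩
      obtain ⟨k, hk, u, hu, hTu⟩ := hy
      have h1 := (f.continuous.tendsto y).comp hTu
      have h2 : Tendsto (fun n => z ^ k n * f (u n)) atTop (𝓝 (0 * f x)) :=
        ((tendsto_pow_atTop_nhds_zero_of_norm_lt_one hlt).comp hk.tendsto_atTop).mul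
          ((f.continuous.tendsto x).comp hu)
      rw [zero_mul] at h2
      rw [tendsto_nhds_unique h1 (h2.congr fun n => (hpow _ _).symm), norm_zero]
    · refine ⟨‖f x‖, fun y hy => ?_⟩
      obtain ⟨k, hk, u, hu, hTu⟩ := hy
      have h1 := ((f.continuous.tendsto y).comp hTu).norm
      have h2 := ((f.continuous.tendsto x).comp hu).norm
      refine tendsto_nhds_unique h1 (h2.congr fun n => ?_)
      rw [Function.comp_apply, Function.comp_apply, hpow, norm_mul, norm_pow, heq, one_pow, one_mul]
  have hopen : IsOpen (f '' interior (JSet T x)) :=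
    f.isOpenMap_of_ne_zero hf0 _ isOpen_interior
  obtain ⟨y, hy⟩ := h
  have hsub : f '' interior (JSet T x) ⊆ Metric.sphere (0 : ℂ) R := by
    rintro _ ⟨v, hv, rfl⟩
    rw [mem_sphere_zero_iff_norm]
    exact hR v (interior_subset hv)
  have hmem : f y ∈ interior (Metric.sphere (0 : ℂ) R) :=
    interior_maximal hsub hopen ⟨y, hy, rfl⟩
  rw [interior_sphere'] at hmem
  exact hmem

end PointSpectrum

/-! ### `l^∞` as the dual of `l^1` -/

section EllOneDuality

theorem EllOne.hasSum_norm (x : EllOne) : HasSum (fun j => ‖x j‖) ‖x‖ := by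
  simpa using lp.hasSum_norm (p := 1) (by simp) x

/-- The pairing of `l^∞` with `l^1`. -/
def ellInftyPairing : EllInfty →L[ℂ] StrongDual ℂ EllOne :=
  lp.dualPairing ∞ 1 (fun _ => ContinuousLinearMap.mul ℂ ℂ) (K := 1) (by simp)

theorem ellInftyPairing_apply (y : EllInfty) (x : EllOne) :
    ellInftyPairing y x = ∑' j, x j * y j := by
  refine (lp.dualPairing_apply _ _ y x).trans (tsum_congr fun j => ?_)
  simp [mul_comm]

theorem ellInftyPairing_single (y : EllInfty) (j : ℕ) :
    ellInftyPairing y (lp.single 1 j 1) = y j := by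
  rw [ellInftyPairing_apply, tsum_eq_single j]
  · simp
  · intro i hi
    simp [hi]

theorem norm_ellInftyPairing (y : EllInfty) : ‖ellInftyPairing y‖ = ‖y‖ := by
  refine le_antisymm ?_ (lp.norm_le_of_forall_le (norm_nonneg _) fun j => ?_)
  · have := ellInftyPairing.le_of_opNorm_le
      (lp.norm_dualPairing (fun _ : ℕ => ContinuousLinearMap.mul ℂ ℂ) (K := 1) (by simp)) y
    simpa using this
  · have := (ellInftyPairing y).le_opNorm (lp.single 1 j 1)
    rwa [ellInftyPairing_single, lp.norm_single (by simp), norm_one, mul_one] at this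

/-- `l^∞` is the dual of `l^1`. -/
def ellInftyEquivDual : EllInfty ≃ₗᵢ[ℂ] StrongDual ℂ EllOne :=
  LinearIsometryEquiv.ofSurjective
    { toLinearMap := ellInftyPairing.toLinearMap, norm_map' := norm_ellInftyPairing } (by
      intro f
      have hmem : Memℓp (fun j => f (lp.single 1 j (1 : ℂ))) ∞ := by
        refine memℓp_infty ⟨‖f‖, ?_⟩
        rintro _ ⟨j, rfl⟩
        have := f.le_opNorm (lp.single 1 j (1 : ℂ))
        rwa [lp.norm_single (by simp), norm_one, mul_one] at this
      refine ⟨⟨_, hmem⟩, ?_⟩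
      ext x
      have h1 := (lp.hasSum_single (p := 1) (by simp) x).mapL f
      refine (ellInftyPairing_apply _ x).trans (Eq.trans ?_ h1.tsum_eq)
      refine tsum_congr fun j => ?_
      have : (lp.single 1 j (x j) : EllOne) = x j • (lp.single 1 j 1 : EllOne) := by
        rw [← lp.single_smul]; simp
      rw [this, map_smul, smul_eq_mul])

theorem ellInftyEquivDual_apply (y : EllInfty) (x : EllOne) :
    ellInftyEquivDual y x = ∑' j, x j * y j := ellInftyPairing_apply y x

end EllOneDuality

/-! ### Schur property and the uniform lower bound -/

section Schur

/-- The Schur property of `l^1`, in the form: a weakly null sequence is not bounded away from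
zero in norm. The proof is a gliding hump argument. -/
theorem EllOne.exists_norm_lt_of_weakly_null {x : ℕ → EllOne}
    (h : ∀ y : EllInfty, Tendsto (fun n => ellInftyEquivDual y (x n)) atTop (𝓝 0))
    {ε : ℝ} (hε : 0 < ε) : ∃ n, ‖x n‖ < ε := by
  by_contra! hx
  have hcoord : ∀ j, Tendsto (fun n => x n j) atTop (𝓝 0) := fun j => by
    refine (h (lp.single ∞ j 1)).congr fun n => ?_
    rw [ellInftyEquivDual_apply, tsum_eq_single j]
    · simp
    · intro i hi
      simp [hi]
  have hnext : ∀ N, ∃ n M, N ≤ n ∧ N < M ∧ ∑ j ∈ Finset.range N, ‖x n j‖ < ε / 8 ∧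
      ‖x n‖ - ε / 8 < ∑ j ∈ Finset.range M, ‖x n j‖ := by
    intro N
    have h1 : Tendsto (fun n => ∑ j ∈ Finset.range N, ‖x n j‖) atTop (𝓝 0) := by
      simpa using tendsto_finsetSum (Finset.range N) fun j _ => (hcoord j).norm
    obtain ⟨n, hn, hnN⟩ := ((h1.eventually (gt_mem_nhds (by positivity : 0 < ε / 8))).and
      (eventually_ge_atTop N)).exists
    obtain ⟨M, hM, hMN⟩ := (((EllOne.hasSum_norm (x n)).tendsto_sum_nat.eventually
      (lt_mem_nhds (by linarith : ‖x n‖ - ε / 8 < ‖x n‖))).and (eventually_gt_atTop N)).exists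
    exact ⟨n, M, hnN, hMN, hn, hM⟩
  choose ν M hν hM hhead htail using hnext
  let P : ℕ → ℕ := fun k => M^[k] 0
  have hP : ∀ k, P (k + 1) = M (P k) := fun k => Function.iterate_succ_apply' M k 0
  have hPmono : StrictMono P := strictMono_nat_of_lt_succ fun k => by rw [hP]; exact hM _
  -- `K j` is the index of the block `[P k, P (k+1))` containing `j`; the search bound `j` suffices
  -- because `k ≤ P k`.
  let K : ℕ → ℕ := fun j => Nat.findGreatest (fun k => P k ≤ j) j
  have hK : ∀ k j, P k ≤ j → j < P (k + 1) → K j = k := by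
    intro k j hkj hjk
    refine Nat.findGreatest_eq_iff.2 ⟨(hPmono.le_apply).trans hkj, fun _ => hkj, fun n hn _ hle => ?_⟩
    exact (hjk.trans_le (hPmono.monotone hn)).not_ge hle
  let s : ℂ → ℂ := fun a => starRingEnd ℂ a / ‖a‖
  have hs : ∀ a, ‖s a‖ ≤ 1 := fun a => by
    simp only [s, norm_div, RCLike.norm_conj, Complex.norm_real, norm_norm]
    exact div_self_le_one _
  have has : ∀ a, a * s a = ‖a‖ := fun a => by
    rcases eq_or_ne a 0 with rfl | ha
    · simp
    · have : (‖a‖ : ℂ) ≠ 0 := by simpa using ha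
      simp only [s]
      rw [← mul_div_assoc, Complex.mul_conj', sq, mul_div_assoc, div_self this, mul_one]
  -- On block `k`, `y` carries the conjugate phases of `x (ν (P k))`. Less than `ε/4` of that
  -- vector's norm lies off the block, and the error is at most twice this, so the pairing is at
  -- least `ε/2`.
  let y : EllInfty := ⟨fun j => s (x (ν (P (K j))) j), memℓp_infty ⟨1, by
    rintro _ ⟨j, rfl⟩; exact hs _⟩⟩
  have hy : ∀ j, y j = s (x (ν (P (K j))) j) := fun _ => rfl
  have hlow : ∀ k, ε / 2 ≤ ‖ellInftyEquivDual y (x (ν (P k)))‖ := by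
    intro k
    set a := x (ν (P k)) with ha
    have hblock : HasSum (fun j => if j ∈ Finset.Ico (P k) (P (k + 1)) then ‖a j‖ else 0)
        (∑ j ∈ Finset.Ico (P k) (P (k + 1)), ‖a j‖) := by
      rw [← Finset.sum_congr rfl fun j hj => if_pos hj]
      exact hasSum_sum_of_ne_finset_zero fun j hj => if_neg hj
    have hdom := ((EllOne.hasSum_norm a).sub hblock).mul_left 2
    have hterm : ∀ j, ‖a j * y j - (‖a j‖ : ℂ)‖ ≤
        2 * (‖a j‖ - if j ∈ Finset.Ico (P k) (P (k + 1)) then ‖a j‖ else 0) := by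
      intro j
      split_ifs with hj
      · rw [Finset.mem_Ico] at hj
        rw [hy, hK k j hj.1 hj.2, ← ha, has]
        simp
      · refine (norm_sub_le _ _).trans ?_
        have h1 : ‖a j‖ * ‖y j‖ ≤ ‖a j‖ * 1 := by gcongr; exact hs _
        rw [norm_mul, Complex.norm_real, norm_norm]
        linarith
    have hbound := tsum_of_norm_bounded hdom hterm
    have hsum1 : Summable fun j => a j * y j := by
      refine Summable.of_norm_bounded (EllOne.hasSum_norm a).summable fun j => ?_
      rw [norm_mul]
      exact mul_le_of_le_one_right (norm_nonneg _) (hs _)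
    have hsum2 : HasSum (fun j => (‖a j‖ : ℂ)) (‖a‖ : ℂ) :=
      Complex.hasSum_ofReal.2 (EllOne.hasSum_norm a)
    rw [hsum1.tsum_sub hsum2.summable, hsum2.tsum_eq, ← ellInftyEquivDual_apply] at hbound
    have hsplit := Finset.sum_range_add_sum_Ico (fun j => ‖a j‖) (hPmono.monotone k.le_succ)
    have h1 := hhead (P k)
    have h2 := htail (P k)
    rw [← hP, ← ha] at h2
    rw [← ha] at h1
    have h3 : ‖a‖ ≤ ‖ellInftyEquivDual y a‖ + ‖ellInftyEquivDual y a - (‖a‖ : ℂ)‖ := by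
      have := norm_sub_norm_le (‖a‖ : ℂ) (ellInftyEquivDual y a)
      rw [Complex.norm_real, norm_norm, norm_sub_rev] at this
      linarith
    have h4 := hx (ν (P k))
    rw [← ha] at h4
    linarith
  have hνP : Tendsto (fun k => ν (P k)) atTop atTop :=
    tendsto_atTop_mono (fun k => hν (P k)) hPmono.tendsto_atTop
  have hlim := ((h y).comp hνP).norm
  rw [norm_zero] at hlim
  exact (half_pos hε).not_ge (ge_of_tendsto' hlim hlow)

theorem exists_bddBelow_of_denseRange {S : EllOne →L[ℂ] EllOne} {T : EllInfty →L[ℂ] EllInfty}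
    (hST : ∀ y x, ellInftyEquivDual (T y) x = ellInftyEquivDual y (S x))
    (hd : ∀ z : ℂ, ‖z‖ ≤ 1 → DenseRange (T - algebraMap ℂ (EllInfty →L[ℂ] EllInfty) z)) :
    ∃ c : ℝ, 0 < c ∧ ∀ z : ℂ, ‖z‖ ≤ 1 → ∀ x, c * ‖x‖ ≤ ‖S x - z • x‖ := by
  by_contra! hcon
  have hseq : ∀ n : ℕ, ∃ z : ℂ, ‖z‖ ≤ 1 ∧ ∃ x : EllOne, ‖x‖ = 1 ∧ ‖S x - z • x‖ < 1 / ((n : ℝ) + 1) := by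
    intro n
    obtain ⟨z, hz, x, hx⟩ := hcon (1 / ((n : ℝ) + 1)) (by positivity)
    have hx0 : 0 < ‖x‖ := by
      refine norm_pos_iff.2 fun h0 => ?_
      simp [h0] at hx
    refine ⟨z, hz, (‖x‖⁻¹ : ℂ) • x, by simp [norm_smul, hx0.ne'], ?_⟩
    rw [map_smul, smul_comm, ← smul_sub, norm_smul, norm_inv, Complex.norm_real, norm_norm,
      inv_mul_eq_div, div_lt_iff₀ hx0]
    exact hx
  choose z hz x hx1 hx using hseq
  obtain ⟨w, hw, φ, hφ, hzw⟩ := (isCompact_closedBall (0 : ℂ) 1).tendsto_subseq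
    (fun n => mem_closedBall_zero_iff.2 (hz n))
  rw [mem_closedBall_zero_iff] at hw
  have hlim : Tendsto (fun n => (S - algebraMap ℂ (EllOne →L[ℂ] EllOne) w) (x (φ n))) atTop
      (𝓝 0) := by
    have h1 : Tendsto (fun n => S (x (φ n)) - z (φ n) • x (φ n)) atTop (𝓝 0) :=
      squeeze_zero_norm (fun n => (hx (φ n)).le)
        (tendsto_one_div_add_atTop_nhds_zero_nat.comp hφ.tendsto_atTop)
    have h2 : Tendsto (fun n => (z (φ n) - w) • x (φ n)) atTop (𝓝 0) := by
      rw [tendsto_zero_iff_norm_tendsto_zero]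
      have := (tendsto_iff_norm_sub_tendsto_zero.1 hzw)
      refine this.congr fun n => ?_
      rw [norm_smul, hx1, mul_one]
      rfl
    have h3 := h1.add h2
    rw [add_zero] at h3
    refine h3.congr fun n => ?_
    simp only [sub_apply, Algebra.algebraMap_eq_smul_one, smul_apply, one_apply_eq_self]
    module
  have hweak : ∀ y : EllInfty, Tendsto (fun n => ellInftyEquivDual y (x (φ n))) atTop (𝓝 0) := by
    intro y
    rw [Metric.tendsto_nhds]
    intro ε hε
    -- Pairing with the range of `T - w` tends to `0` because `(S - w) x → 0` in norm; density
    -- extends this to every `y`.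
    obtain ⟨v, hv⟩ := (hd w hw).exists_dist_lt y (half_pos hε)
    have h1 : Tendsto (fun n => ellInftyEquivDual v
        ((S - algebraMap ℂ (EllOne →L[ℂ] EllOne) w) (x (φ n)))) atTop (𝓝 0) := by
      rw [← map_zero (ellInftyEquivDual v)]
      exact ((ellInftyEquivDual v).continuous.tendsto 0).comp hlim
    filter_upwards [(Metric.tendsto_nhds.1 h1) _ (half_pos hε)] with n hn
    rw [dist_zero_right, ← dual_sub_algebraMap_apply ellInftyEquivDual hST] at hn
    rw [dist_zero_right]
    set u := (T - algebraMap ℂ (EllInfty →L[ℂ] EllInfty) w) v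
    have h2 : ‖ellInftyEquivDual (y - u) (x (φ n))‖ ≤ dist y u := by
      have := (ellInftyEquivDual (y - u)).le_opNorm (x (φ n))
      rwa [hx1, mul_one, LinearIsometryEquiv.norm_map, ← dist_eq_norm] at this
    rw [map_sub, sub_apply] at h2
    have h3 := norm_sub_norm_le (ellInftyEquivDual y (x (φ n))) (ellInftyEquivDual u (x (φ n)))
    linarith
  obtain ⟨n, hn⟩ := EllOne.exists_norm_lt_of_weakly_null hweak one_pos
  exact hn.ne (hx1 _)

end Schur

/-! ### Spectral consequences for `T = S*` -/

section Adjoint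

theorem IsAdjointOf.ellInftyEquivDual_apply {S : EllOne →L[ℂ] EllOne}
    {T : EllInfty →L[ℂ] EllInfty} (hT : IsAdjointOf T S) (y : EllInfty) (x : EllOne) :
    ellInftyEquivDual (T y) x = ellInftyEquivDual y (S x) := by
  rw [_root_.ellInftyEquivDual_apply, _root_.ellInftyEquivDual_apply, hT x y]

theorem denseRange_of_notMem_pointSpectrum {Y : Type*} [NormedAddCommGroup Y] [NormedSpace ℂ Y]
    {T : Y →L[ℂ] Y} {z : ℂ} (h : z ∉ pointSpectrum (banachAdjoint T)) :
    DenseRange (T - algebraMap ℂ (Y →L[ℂ] Y) z) := by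
  by_contra hd
  obtain ⟨f, hf0, hf⟩ := exists_dual_comp_eq_zero hd
  refine h (mem_pointSpectrum_iff.2 ⟨f, hf0, ?_⟩)
  ext y
  have := hf y
  simp only [sub_apply, Algebra.algebraMap_eq_smul_one, smul_apply, one_apply_eq_self, map_sub,
    map_smul, sub_eq_zero] at this
  exact this

variable {S : EllOne →L[ℂ] EllOne} {T : EllInfty →L[ℂ] EllInfty}

theorem IsAdjointOf.exists_bddBelow (hT : IsAdjointOf T S)
    (h : pointSpectrum (banachAdjoint T) ∩ Metric.closedBall (0 : ℂ) 1 = ∅) :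
    ∃ c : ℝ, 0 < c ∧ ∀ z : ℂ, ‖z‖ ≤ 1 → ∀ x, c * ‖x‖ ≤ ‖S x - z • x‖ :=
  exists_bddBelow_of_denseRange hT.ellInftyEquivDual_apply fun z hz =>
    denseRange_of_notMem_pointSpectrum fun hmem =>
      Set.eq_empty_iff_forall_notMem.1 h z ⟨hmem, mem_closedBall_zero_iff.2 hz⟩

instance EllOne.instNontrivial : Nontrivial EllOne :=
  ⟨⟨lp.single 1 0 1, 0, fun h => by
    have := congrArg (fun x : EllOne => x 0) h
    simp at this⟩⟩

theorem IsAdjointOf.spectrum_inter_sphere_nonempty (hT : IsAdjointOf T S) {x : EllInfty}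
    (hx : x ≠ 0) (hJ : (interior (JSet T x)).Nonempty) :
    (spectrum ℂ T ∩ Metric.sphere (0 : ℂ) 1).Nonempty := by
  obtain ⟨c, hc, hb⟩ := hT.exists_bddBelow (pointSpectrum_banachAdjoint_inter_closedBall hJ)
  have hi := one_lt_injRadius_of_bddBelow hc hb
  -- If `1` were in the resolvent set, invertibility would pass from `T - 1` to `S - 1`, across the
  -- disc to `S`, and back to `T`, forcing `x = 0`.
  refine ⟨1, fun hres => hx ?_, by simp⟩
  have hdual := dual_sub_algebraMap_apply ellInftyEquivDual hT.ellInftyEquivDual_apply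
  have hb' : ∀ z : ℂ, ‖z‖ ≤ 1 → ∀ x, c * ‖x‖ ≤ ‖(S - algebraMap ℂ (EllOne →L[ℂ] EllOne) z) x‖ :=
    fun z hz x => by
      simpa [Algebra.algebraMap_eq_smul_one] using hb z hz x
  have hT1 : IsUnit (T - algebraMap ℂ (EllInfty →L[ℂ] EllInfty) 1) := by
    rw [← IsUnit.neg_iff, neg_sub]
    exact hres
  have hS1 := isUnit_of_isUnit_dual ellInftyEquivDual (hdual 1) hc (hb' 1 (by simp)) hT1
  have hS0 := isUnit_sub_of_bddBelow hc hb (by simp) (by simp : ‖(0 : ℂ)‖ ≤ 1) hS1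
  have hT0 := isUnit_dual_of_isUnit ellInftyEquivDual (hdual 0) hc (hb' 0 (by simp)) hS0
  rw [map_zero, sub_zero, ContinuousLinearMap.isUnit_iff_bijective] at hT0
  obtain ⟨y, hy⟩ := hJ
  exact eq_zero_of_mem_JSet_of_injective ellInftyEquivDual hT.ellInftyEquivDual_apply hi hT0.1
    (interior_subset hy)

theorem IsAdjointOf.closedBall_subset_pointSpectrum (hT : IsAdjointOf T S)
    (hσ : (spectrum ℂ T ∩ Metric.sphere (0 : ℂ) 1).Nonempty) {c : ℝ} (hc : 0 < c)
    (hb : ∀ z : ℂ, ‖z‖ ≤ 1 → ∀ x, c * ‖x‖ ≤ ‖S x - z • x‖) :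
    Metric.closedBall (0 : ℂ) 1 ⊆ pointSpectrum T := by
  intro w hw
  rw [mem_closedBall_zero_iff] at hw
  obtain ⟨z, hzσ, hz⟩ := hσ
  rw [mem_sphere_zero_iff_norm] at hz
  have hdual := dual_sub_algebraMap_apply ellInftyEquivDual hT.ellInftyEquivDual_apply
  have hb' : ∀ z : ℂ, ‖z‖ ≤ 1 → ∀ x, c * ‖x‖ ≤ ‖(S - algebraMap ℂ (EllOne →L[ℂ] EllOne) z) x‖ :=
    fun z hz x => by
      simpa [Algebra.algebraMap_eq_smul_one] using hb z hz x
  have hninj : ¬ Function.Injective (T - algebraMap ℂ (EllInfty →L[ℂ] EllInfty) w) := by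
    intro hinj
    have hbij := bijective_of_bddBelow_of_denseRange hc (hb' w hw)
      (denseRange_of_dual_injective ellInftyEquivDual (hdual w) hinj)
    have hSz := isUnit_sub_of_bddBelow hc hb hw hz.le
      (ContinuousLinearMap.isUnit_iff_bijective.2 hbij)
    have hTz := isUnit_dual_of_isUnit ellInftyEquivDual (hdual z) hc (hb' z hz.le) hSz
    rw [← IsUnit.neg_iff, neg_sub] at hTz
    exact hzσ hTz
  rw [injective_iff_map_eq_zero] at hninj
  push Not at hninj
  obtain ⟨y, hy, hy0⟩ := hninj
  refine mem_pointSpectrum_iff.2 ⟨y, hy0, ?_⟩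
  simpa [Algebra.algebraMap_eq_smul_one, sub_eq_zero] using hy

end Adjoint

/-! ### The equivalences -/

section JClass

variable {E : Type*} [NormedAddCommGroup E] [NormedSpace ℂ E] {T : E →L[ℂ] E}

theorem JMixSet_subset_JSet (x : E) : JMixSet T x ⊆ JSet T x := by
  rintro y ⟨u, hu, hTu⟩
  exact ⟨id, strictMono_id, u, hu, hTu⟩

theorem IsJMixClass.isJClass (h : IsJMixClass T) : IsJClass T := by
  obtain ⟨x, hx, hJ⟩ := h
  exact ⟨x, hx, Set.univ_subset_iff.1 (hJ ▸ JMixSet_subset_JSet x)⟩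

end JClass

theorem corollary3p6 (S : EllOne →L[ℂ] EllOne) (T : EllInfty →L[ℂ] EllInfty)
    (hT : IsAdjointOf T S) :
    -- the limit that defines `i(S)` exists
    Tendsto (fun n : ℕ => injModulus (S ^ n) ^ (1 / (n : ℝ))) atTop (𝓝 (injRadius S)) ∧
    List.TFAE [
      IsJMixClass T,
      IsJClass T,
      ∃ x : EllInfty, x ≠ 0 ∧ (interior (JSet T x)).Nonempty,
      (spectrum ℂ T ∩ Metric.sphere (0 : ℂ) 1).Nonempty ∧
        pointSpectrum (banachAdjoint T) ∩ Metric.closedBall (0 : ℂ) 1 = ∅,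
      1 < injRadius S ∧ Metric.closedBall (0 : ℂ) 1 ⊆ pointSpectrum T,
      1 < injRadius S ∧ (0 : ℂ) ∈ pointSpectrum T] ∧
    (IsJClass T ↔ 1 < injRadius S ∧ ∃ x : EllInfty, x ≠ 0 ∧ T x = 0) := by
  have hker : (0 : ℂ) ∈ pointSpectrum T ↔ ∃ x : EllInfty, x ≠ 0 ∧ T x = 0 := by
    simp only [mem_pointSpectrum_iff, zero_smul]
  refine ⟨tendsto_injRadius S, ?_⟩
  rw [← hker]
  -- Indices start at `0`: the last claim is (ii) ↔ (vi).
  refine (fun htfae => ⟨htfae, htfae.out 1 5⟩ : List.TFAE _ → _) ?_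
  tfae_have 1 → 2 := IsJMixClass.isJClass
  tfae_have 2 → 3 := fun ⟨x, hx, hJ⟩ => ⟨x, hx, by rw [hJ, interior_univ]; exact Set.univ_nonempty⟩
  tfae_have 3 → 4 := fun ⟨_, hx, hJ⟩ =>
    ⟨hT.spectrum_inter_sphere_nonempty hx hJ, pointSpectrum_banachAdjoint_inter_closedBall hJ⟩
  tfae_have 4 → 5 := fun ⟨hσ, hp⟩ => by
    obtain ⟨c, hc, hb⟩ := hT.exists_bddBelow hp
    exact ⟨one_lt_injRadius_of_bddBelow hc hb, hT.closedBall_subset_pointSpectrum hσ hc hb⟩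
  tfae_have 5 → 6 := fun ⟨hi, hσ⟩ => ⟨hi, hσ (by simp)⟩
  tfae_have 6 → 1 := fun ⟨hi, h0⟩ => by
    obtain ⟨x, hx, hTx⟩ := hker.1 h0
    exact ⟨x, hx, JMixSet_eq_univ_of_mem_ker ellInftyEquivDual hT.ellInftyEquivDual_apply hi hTx⟩
  tfae_finish
end
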